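/- There is an absolute constant $C>0$ (depending only on the domain $(-1,1)$) such that the following holds. Let $K>1$ and let $f:(-1,1)\to\mathbb C$ be a function in $H^1(-1,1)$ whose support is a compact subset of the open interval $(-1,1)$. For every frequency $\alpha\in(0,K)$ let $u(\cdot,\alpha)\in H^2(-1,1)$ be the solution of the Helmholtz equation $$u''(x,\alpha)+\alpha^2u(x,\alpha)=f(x)\quad\text{for } x\in(-1,1),$$ with the outgoing conditions $$u'(1,\alpha)+i\alpha\,u(1,\alpha)=0,\qquad u'(-1,\alpha)-i\alpha\,u(-1,\alpha)=0 .$$ Then the function $\alpha\mapsto\alpha^2\big(|u(1,\alpha)|^2+|u(-1,\alpha)|^2\big)$ is integrable on $(0,K)$, and $$\|f\|_{L^2(-1,1)}^2\le C\Big(\varepsilon^2+\frac{M^2}{1+K^{2/3}E^{1/4}}\Big),$$ where $\varepsilon\ge 0$ is given by $$\varepsilon^2=\int_0^K\alpha^2\big(|u(1,\alpha)|^2+|u(-1,\alpha)|^2\big)\,d\alpha,$$ $M=\max\{\|f\|_{H^1(-1,1)}^2,\,1\}$ with $\|f\|_{H^1(-1,1)}^2=\|f\|_{L^2(-1,1)}^2+\|f'\|_{L^2(-1,1)}^2$,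 and $E=-\ln\varepsilon$ if $0<\varepsilon<1$. If $\varepsilon\ge1$, then $E$ is read as $0$; if $\varepsilon=0$, then $E=\infty$ and the fraction is read as $0$ (so that $f=0$). -/

import Mathlib

open MeasureTheory Set
open scoped ContDiff

namespace Helmholtz

/-- The domain, the open interval from `-1` to `1`. -/
def Ω : Set ℝ := Ioo (-1) 1

/-- `g` is the weak derivative of `f` on the domain:
`∫ φ' f = - ∫ φ g` for all smooth `φ` with compact support in the domain. -/
structure HasWeakDeriv (f g : ℝ → ℂ) : Prop where
  locallyIntegrableOn : LocallyIntegrableOn f Ω volume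
  locallyIntegrableOn_deriv : LocallyIntegrableOn g Ω volume
  integral_eq : ∀ φ : ℝ → ℝ, ContDiff ℝ ∞ φ → HasCompactSupport φ → tsupport φ ⊆ Ω →
    ∫ x in Ω, deriv φ x • f x = -∫ x in Ω, φ x • g x

/-- Weak derivatives are unique up to null sets. -/
theorem HasWeakDeriv.ae_eq {f g h : ℝ → ℂ} (hg : HasWeakDeriv f g) (hh : HasWeakDeriv f h) :
    ∀ᵐ x ∂(volume.restrict Ω), g x = h x := by
  have hΩ : IsOpen Ω := isOpen_Ioo
  rw [ae_restrict_iff' hΩ.measurableSet]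
  have hz : ∀ φ : ℝ → ℝ, tsupport φ ⊆ Ω → ∀ x, x ∉ Ω → φ x = 0 := fun φ h3 x hx =>
    image_eq_zero_of_notMem_tsupport fun hx' => hx (h3 hx')
  have hint : ∀ φ : ℝ → ℝ, ContDiff ℝ ∞ φ → HasCompactSupport φ → tsupport φ ⊆ Ω →
      ∀ k : ℝ → ℂ, LocallyIntegrableOn k Ω volume → Integrable (fun x => φ x • k x) volume := by
    intro φ h1 h2 h3 k hk
    have hi : IntegrableOn (fun x => φ x • k x) (tsupport φ) volume :=
      (hk.integrableOn_compact_subset h3 h2).continuousOn_smul h1.continuous.continuousOn h2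
    exact (integrableOn_iff_integrable_of_support_subset
      (fun x hx => subset_tsupport φ (fun h => hx (by simp [h])))).1 hi
  have main := hΩ.ae_eq_zero_of_integral_contDiff_smul_eq_zero (f := fun x => g x - h x)
    (hg.locallyIntegrableOn_deriv.sub hh.locallyIntegrableOn_deriv) (fun φ h1 h2 h3 => by
      have key := neg_injective
        ((hg.integral_eq φ h1 h2 h3).symm.trans (hh.integral_eq φ h1 h2 h3))
      rw [setIntegral_eq_integral_of_forall_compl_eq_zero (fun x hx => by simp [hz φ h3 x hx]),
        setIntegral_eq_integral_of_forall_compl_eq_zero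
          (fun x hx => by simp [hz φ h3 x hx])] at key
      simp only [smul_sub]
      rw [integral_sub (hint φ h1 h2 h3 g hg.locallyIntegrableOn_deriv)
        (hint φ h1 h2 h3 h hh.locallyIntegrableOn_deriv), key, sub_self])
  filter_upwards [main] with x hx hxΩ
  exact sub_eq_zero.1 (hx hxΩ)

/-- Square integrability on the domain. -/
def MemL2 (f : ℝ → ℂ) : Prop := MemLp f 2 (volume.restrict Ω)

/-- The squared `L²` norm on the domain. -/
noncomputable def l2NormSq (f : ℝ → ℂ) : ℝ := ∫ x in Ω, ‖f x‖ ^ 2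

/-- The Sobolev space `H¹` of the domain. -/
def MemH1 (f : ℝ → ℂ) : Prop := MemL2 f ∧ ∃ g, MemL2 g ∧ HasWeakDeriv f g

open Classical in
/-- The square integrable weak derivative of a function in `H¹`
(unique up to null sets; the value `0` is used outside `H¹`). -/
noncomputable def weakDeriv (f : ℝ → ℂ) : ℝ → ℂ :=
  if h : ∃ g, MemL2 g ∧ HasWeakDeriv f g then h.choose else 0

/-- The squared `H¹` norm on the domain. -/
noncomputable def h1NormSq (f : ℝ → ℂ) : ℝ := l2NormSq f + l2NormSq (weakDeriv f)

/-- The (essential) support of `f` is a compact subset of the open domain. -/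
def SupportedInside (f : ℝ → ℂ) : Prop :=
  ∃ S : Set ℝ, IsCompact S ∧ S ⊆ Ω ∧ ∀ᵐ x ∂(volume.restrict Ω), x ∉ S → f x = 0

/-- `u ∈ H²` solves `u'' + k² u = f` on the domain with the outgoing conditions
`u'(1) + i k u(1) = 0` and `u'(-1) - i k u(-1) = 0`.  Here `u` and `v = u'` are the continuous
representatives on the closed interval, which give the values at the end points, and `w = u''`
is the second weak derivative. -/
def IsOutgoingSolution (k : ℝ) (f u : ℝ → ℂ) : Prop :=
  ∃ v w : ℝ → ℂ,
    ContinuousOn u (Icc (-1) 1) ∧ ContinuousOn v (Icc (-1) 1) ∧ MemL2 w ∧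
    HasWeakDeriv u v ∧ HasWeakDeriv v w ∧
    (∀ᵐ x ∂(volume.restrict Ω), w x + (k : ℂ) ^ 2 * u x = f x) ∧
    v 1 + Complex.I * k * u 1 = 0 ∧
    v (-1) - Complex.I * k * u (-1) = 0

/-- The density `α² (|u(1,α)|² + |u(-1,α)|²)` of the boundary data. -/
noncomputable def dataDensity (u : ℝ → ℝ → ℂ) (α : ℝ) : ℝ :=
  α ^ 2 * (‖u 1 α‖ ^ 2 + ‖u (-1) α‖ ^ 2)

/-- The size `ε` of the boundary data for the frequencies between `0` and `K`. -/
noncomputable def dataSize (K : ℝ) (u : ℝ → ℝ → ℂ) : ℝ :=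
  Real.sqrt (∫ α in (0)..K, dataDensity u α)

/-- The high frequency term `M² / (1 + K^(2/3) E^(1/4))` with `E = - ln ε`.
For `ε = 0` one has `E = ∞` and the term is `0`; for `ε ≥ 1`, where `- ln ε` is not positive,
`E` is read as `0` and the term is `M²`. -/
noncomputable def tailTerm (K M ε : ℝ) : ℝ :=
  if ε = 0 then 0
  else M ^ 2 / (1 + K ^ (2 / 3 : ℝ) * (max (-Real.log ε) 0) ^ (1 / 4 : ℝ))

end Helmholtz

/-!
Let `F(ξ) = ∫_Ω e^{iξx} f(x) dx`. Testing the equation with `cos (αx)` and `sin (αx)` and using the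
outgoing conditions gives `F(±α) = -2iα e^{iα} u(±1, α)` (`IsOutgoingSolution.transform_eq`), so the
data are the values of `|F|²` at the frequencies up to `K`, and `4 ε² = ∫_{|ξ| < K} |F|²`
(`bandEnergy_eq_dataSize`). By Plancherel's identity (`integral_sq_transform`) what has to be
bounded is the energy of `F` at high frequencies.

* Beyond any cutoff `s`, the energy is at most `2π ‖f'‖² / s²`, since the transform of `f'` is
  `-iξ F(ξ)`; this is where the support of `f` inside `Ω` enters (`l2NormSq_le_bandEnergy_add`).
* Up to `s`, the energy is controlled by that at frequencies up to `1`
  (`integral_sq_transform_le`). For a small step `h` and `z = e^{ihx}` one has `|z - 1| ≤ h` on `Ω`,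
  so the expansion of `z ^ m` in powers of `z - 1` may be truncated at degree `N = 1 / h`. This
  bounds `F(t + mh)` by the values `F(t + jh)`, `j < N`, with amplification `3 ^ m` and an
  error that is exponentially small in `s` once `N ≥ 8 s`. In total
  `∫_{|ξ| ≤ s} |F|² ≲ e^{33 s²} ε² + e^{-4s} s ‖f‖²`.

Thus `‖f‖² ≲ e^{33 s²} ε² + ‖f‖²_{H¹} / s²` for every `s ≥ 1`. With `r = K^{2/3} E^{1/4}`, the
cutoff `K` suffices if `r ≤ K²`. If `r > K²`, then `E ≥ r²`, so `ε² ≤ e^{-2r²}` beats the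
amplification `e^{33 r}` for the cutoff `s = √r` (`exp_mul_sq_le`). For `ε = 0`, let `s → ∞`.
-/

namespace Helmholtz

/-! ### The Fourier transform of functions on the interval -/

/-- The Fourier transform `ξ ↦ ∫_Ω e^{iξx} f(x) dx`, in the normalization without `2π` in the
exponent. -/
noncomputable def transform (f : ℝ → ℂ) (ξ : ℝ) : ℂ :=
  ∫ x in Ω, Complex.exp (Complex.I * (ξ * x : ℝ)) * f x

instance isFiniteMeasure_restrict : IsFiniteMeasure (volume.restrict Ω) :=
  ⟨by simp [Ω]⟩

lemma MemL2.integrable {f : ℝ → ℂ} (hf : MemL2 f) : IntegrableOn f Ω :=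
  MemLp.integrable one_le_two hf

lemma MemL2.integrable_sq {f : ℝ → ℂ} (hf : MemL2 f) : IntegrableOn (fun x => ‖f x‖ ^ 2) Ω :=
  (memLp_two_iff_integrable_sq_norm hf.1).1 hf

lemma l2NormSq_nonneg (f : ℝ → ℂ) : 0 ≤ l2NormSq f :=
  integral_nonneg fun _ => by positivity

lemma norm_exp_I_mul_real (t : ℝ) : ‖Complex.exp (Complex.I * (t : ℂ))‖ = 1 := by
  rw [mul_comm, Complex.norm_exp_ofReal_mul_I]

lemma integrableOn_exp_mul {f : ℝ → ℂ} (hf : IntegrableOn f Ω) (ξ : ℝ) :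
    IntegrableOn (fun x : ℝ => Complex.exp (Complex.I * (ξ * x : ℝ)) * f x) Ω :=
  Integrable.bdd_mul (c := 1) hf (by fun_prop) (.of_forall fun x => (norm_exp_I_mul_real _).le)

lemma continuous_transform {f : ℝ → ℂ} (hf : IntegrableOn f Ω) : Continuous (transform f) := by
  refine continuous_of_dominated (bound := fun x => ‖f x‖)
    (fun ξ => (integrableOn_exp_mul hf ξ).1) (fun ξ => .of_forall fun x => ?_) hf.norm
    (.of_forall fun x => by fun_prop)
  rw [norm_mul, norm_exp_I_mul_real, one_mul]

lemma sq_integral_norm_le {f : ℝ → ℂ} (hf : MemL2 f) :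
    (∫ x in Ω, ‖f x‖) ^ 2 ≤ 2 * l2NormSq f := by
  set A := ∫ x in Ω, ‖f x‖ with hA
  have h0 : 0 ≤ ∫ x in Ω, (‖f x‖ - A / 2) ^ 2 := integral_nonneg fun _ => by positivity
  have hv : volume.real Ω = 2 := by simp [Ω]; norm_num
  have h1 : ∫ x in Ω, (‖f x‖ - A / 2) ^ 2 = l2NormSq f - A * A + A ^ 2 / 4 * 2 := by
    have he : ∀ x, (‖f x‖ - A / 2) ^ 2 = ‖f x‖ ^ 2 - A * ‖f x‖ + A ^ 2 / 4 := fun x => by ring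
    simp_rw [he]
    have hi : IntegrableOn (fun x => ‖f x‖ ^ 2 - A * ‖f x‖) Ω :=
      hf.integrable_sq.sub (hf.integrable.norm.const_mul A)
    rw [integral_add hi (integrable_const _), integral_sub hf.integrable_sq (hf.integrable.norm.const_mul A), integral_const_mul, ← hA]
    simp [hv, l2NormSq]
    ring
  nlinarith

/-- Parseval's identity for the Fourier series of `x ↦ e^{iθx} f(x)` on an interval of length `2`,
whose coefficients are the values of the transform at the points `θ + nπ`. -/
lemma hasSum_sq_transform_add_zsmul {f : ℝ → ℂ} (hf : MemL2 f) (θ : ℝ) :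
    HasSum (fun n : ℤ => ‖transform f (θ + n * Real.pi)‖ ^ 2) (2 * l2NormSq f) := by
  have hab : (-1 : ℝ) < 1 := by norm_num
  have hr : volume.restrict (Ioc (-1 : ℝ) 1) = volume.restrict Ω :=
    (Measure.restrict_congr_set Ioo_ae_eq_Ioc).symm
  set g : ℝ → ℂ := fun x => Complex.exp (Complex.I * (θ * x : ℝ)) * f x with hg
  have hgn : ∀ x, ‖g x‖ = ‖f x‖ := fun x => by
    simp only [hg]; rw [norm_mul, norm_exp_I_mul_real, one_mul]
  have hg2 : MemLp g 2 (volume.restrict (Ioc (-1 : ℝ) 1)) := by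
    rw [hr]
    exact (memLp_congr_norm (integrableOn_exp_mul hf.integrable θ).1 hf.1
      (.of_forall hgn)).2 hf
  have h := (hasSum_sq_fourierCoeffOn hab hg2).mul_left 4
  have h2 : (4 : ℝ) * ((1 - (-1 : ℝ))⁻¹ • ∫ x in (-1 : ℝ)..1, ‖g x‖ ^ 2) = 2 * l2NormSq f := by
    simp_rw [hgn]
    rw [intervalIntegral.integral_of_le hab.le, hr, l2NormSq, smul_eq_mul]
    ring
  rw [h2] at h
  rw [← (Equiv.neg ℤ).hasSum_iff]
  suffices he : ∀ n : ℤ, ((fun n : ℤ => ‖transform f (θ + n * Real.pi)‖ ^ 2) ∘ Equiv.neg ℤ) n =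
      4 * ‖fourierCoeffOn hab g n‖ ^ 2 from (funext he) ▸ h
  intro n
  have h3 : ∀ x : ℝ, fourier (-n) (x : AddCircle (1 - (-1 : ℝ))) • g x =
      Complex.exp (Complex.I * ((θ + (-n : ℤ) * Real.pi) * x : ℝ)) * f x := fun x => by
    rw [fourier_coe_apply, smul_eq_mul, hg]
    simp only
    rw [← mul_assoc, ← Complex.exp_add]
    congr 2
    push_cast
    ring
  rw [fourierCoeffOn_eq_integral, intervalIntegral.integral_of_le hab.le, hr]
  simp_rw [h3]
  simp only [Function.comp_apply, Equiv.neg_apply, transform]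
  rw [norm_smul, mul_pow, ← mul_assoc]
  norm_num

/-- **Plancherel's identity** for the lower integral, which includes integrability: Parseval's
identity for the shifted Fourier series is integrated over one period of the shift. -/
lemma lintegral_sq_transform {f : ℝ → ℂ} (hf : MemL2 f) :
    ∫⁻ ξ, ENNReal.ofReal (‖transform f ξ‖ ^ 2) = ENNReal.ofReal (2 * Real.pi * l2NormSq f) := by
  have hc := continuous_transform hf.integrable
  have hpi := Real.pi_pos
  set G : ℝ → ENNReal := fun ξ => ENNReal.ofReal (‖transform f ξ‖ ^ 2) with hG
  have hGm : Measurable G := by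
    exact ENNReal.measurable_ofReal.comp (by fun_prop : Continuous _).measurable
  have h1 : ∫⁻ ξ, G ξ = ∑' n : ℤ, ∫⁻ ξ in Ioc 0 Real.pi, G (ξ + n * Real.pi) := by
    rw [← setLIntegral_univ, ← iUnion_Ioc_add_zsmul hpi 0,
      lintegral_iUnion (fun _ => measurableSet_Ioc) (pairwise_disjoint_Ioc_add_zsmul 0 Real.pi)]
    refine tsum_congr fun n => ?_
    rw [← (measurePreserving_add_right volume (n * Real.pi)).setLIntegral_comp_preimage_emb
      (measurableEmbedding_addRight _)]
    congr 2
    ext x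
    simp only [mem_preimage, mem_Ioc, zsmul_eq_mul]
    push_cast
    constructor <;> rintro ⟨h, h'⟩ <;> constructor <;> linarith
  have hGn : ∀ n : ℤ, Measurable fun ξ => G (ξ + n * Real.pi) := fun n =>
    hGm.comp (measurable_id.add_const _)
  rw [h1, ← lintegral_tsum (fun n => (hGn n).aemeasurable)]
  have h2 : ∀ ξ, ∑' n : ℤ, G (ξ + n * Real.pi) = ENNReal.ofReal (2 * l2NormSq f) := fun ξ => by
    have h := hasSum_sq_transform_add_zsmul hf ξ
    rw [← h.tsum_eq, ENNReal.ofReal_tsum_of_nonneg (fun _ => by positivity) h.summable]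
  simp_rw [h2]
  rw [setLIntegral_const, Real.volume_Ioc, sub_zero,
    ← ENNReal.ofReal_mul (by have := l2NormSq_nonneg f; positivity)]
  congr 1; ring

lemma integrable_sq_transform {f : ℝ → ℂ} (hf : MemL2 f) :
    Integrable (fun ξ => ‖transform f ξ‖ ^ 2) := by
  have hc := continuous_transform hf.integrable
  refine ⟨by fun_prop, ?_⟩
  rw [hasFiniteIntegral_iff_ofReal (.of_forall fun _ => by positivity), lintegral_sq_transform hf]
  exact ENNReal.ofReal_lt_top

lemma integral_sq_transform {f : ℝ → ℂ} (hf : MemL2 f) :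
    ∫ ξ, ‖transform f ξ‖ ^ 2 = 2 * Real.pi * l2NormSq f := by
  rw [integral_eq_lintegral_of_nonneg_ae (.of_forall fun _ => by positivity)
    (integrable_sq_transform hf).1, lintegral_sq_transform hf, ENNReal.toReal_ofReal]
  have := l2NormSq_nonneg f
  positivity

/-! ### Extrapolation to high frequencies -/

/-- Newton's forward interpolation of the power `z ^ m`: the expansion in powers of `z - 1` is
truncated at degree `N`. -/
lemma exists_approx_pow (m N : ℕ) :
    ∃ c : ℕ → ℂ, (∀ j, ‖c j‖ ≤ 3 ^ m) ∧ ∀ z : ℂ,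
      ‖z ^ m - ∑ j ∈ Finset.range N, c j * z ^ j‖ ≤ (1 / 2) ^ N * (1 + 2 * ‖z - 1‖) ^ m := by
  classical
  set S := (Finset.range (m + 1)).filter (· < N) with hS
  refine ⟨fun j => ∑ n ∈ S, (m.choose n : ℂ) * (n.choose j * (-1) ^ (n - j)), fun j => ?_,
    fun z => ?_⟩
  · calc ‖∑ n ∈ S, (m.choose n : ℂ) * (n.choose j * (-1) ^ (n - j))‖
        ≤ ∑ n ∈ S, (m.choose n : ℝ) * 2 ^ n := by
          refine (norm_sum_le _ _).trans (Finset.sum_le_sum fun n _ => ?_)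
          rw [norm_mul, norm_mul, norm_pow, norm_neg, norm_one, one_pow, mul_one,
            Complex.norm_natCast, Complex.norm_natCast]
          gcongr
          exact_mod_cast Nat.choose_le_two_pow n j
      _ ≤ ∑ n ∈ Finset.range (m + 1), (m.choose n : ℝ) * 2 ^ n :=
          Finset.sum_le_sum_of_subset_of_nonneg (Finset.filter_subset _ _)
            fun _ _ _ => by positivity
      _ = 3 ^ m := by
          rw [show (3 : ℝ) = 2 + 1 by norm_num, add_pow]
          exact Finset.sum_congr rfl fun n _ => by rw [one_pow]; ring
  · have h1 : z ^ m = ∑ n ∈ Finset.range (m + 1), (m.choose n : ℂ) * (z - 1) ^ n := by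
      conv_lhs => rw [show z = (z - 1) + 1 by ring, add_pow]
      exact Finset.sum_congr rfl fun n _ => by rw [one_pow]; ring
    have h2 : ∑ j ∈ Finset.range N, (∑ n ∈ S, (m.choose n : ℂ) *
        (n.choose j * (-1) ^ (n - j))) * z ^ j = ∑ n ∈ S, (m.choose n : ℂ) * (z - 1) ^ n := by
      simp_rw [Finset.sum_mul]
      rw [Finset.sum_comm]
      refine Finset.sum_congr rfl fun n hn => ?_
      have hnN : n < N := (Finset.mem_filter.1 hn).2
      rw [sub_eq_add_neg, add_pow, Finset.mul_sum]
      refine (Finset.sum_subset (Finset.range_subset_range.2 hnN) fun j _ hj => ?_).symm.trans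
        (Finset.sum_congr rfl fun j _ => by ring)
      rw [Nat.choose_eq_zero_of_lt (show n < j by simpa using hj)]
      simp
    rw [h2, h1, ← Finset.sum_filter_add_sum_filter_not (Finset.range (m + 1)) (· < N),
      add_sub_cancel_left]
    calc _ ≤ ∑ n ∈ (Finset.range (m + 1)).filter (¬ · < N),
          (1 / 2) ^ N * ((m.choose n : ℝ) * (2 * ‖z - 1‖) ^ n) := by
          refine (norm_sum_le _ _).trans (Finset.sum_le_sum fun n hn => ?_)
          have hNn : N ≤ n := not_lt.1 (Finset.mem_filter.1 hn).2
          rw [norm_mul, norm_pow, Complex.norm_natCast]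
          -- each omitted term has degree `n ≥ N`, hence gains the factor `2 ^ (n - N) ≥ 1`
          have h3 : (1 : ℝ) ≤ (1 / 2) ^ N * 2 ^ n := by
            obtain ⟨k, rfl⟩ := Nat.exists_eq_add_of_le hNn
            rw [pow_add, ← mul_assoc, ← mul_pow]
            norm_num
            exact one_le_pow₀ (by norm_num)
          calc (m.choose n : ℝ) * ‖z - 1‖ ^ n ≤
                ((1 / 2) ^ N * 2 ^ n) * ((m.choose n : ℝ) * ‖z - 1‖ ^ n) :=
                le_mul_of_one_le_left (by positivity) h3
            _ = _ := by rw [mul_pow]; ring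
      _ ≤ ∑ n ∈ Finset.range (m + 1),
          (1 / 2) ^ N * ((m.choose n : ℝ) * (2 * ‖z - 1‖) ^ n) :=
          Finset.sum_le_sum_of_subset_of_nonneg (Finset.filter_subset _ _)
            fun _ _ _ => by positivity
      _ = _ := by
          rw [← Finset.mul_sum, add_comm (1 : ℝ), add_pow]
          congr 1
          exact Finset.sum_congr rfl fun n _ => by rw [one_pow]; ring

/-- The transform at a far point of an arithmetic progression is controlled by its values at the
first `N` points, since `e^{ihx}` is close to `1` on `Ω` for a small step `h`. -/
lemma norm_transform_add_mul_le {f : ℝ → ℂ} (hf : IntegrableOn f Ω) (t h : ℝ) (m N : ℕ) :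
    ‖transform f (t + m * h)‖ ≤ 3 ^ m * ∑ j ∈ Finset.range N, ‖transform f (t + j * h)‖ +
      (1 / 2) ^ N * Real.exp (2 * (m * |h|)) * ∫ x in Ω, ‖f x‖ := by
  obtain ⟨c, hc, hz⟩ := exists_approx_pow m N
  have hpow : ∀ (j : ℕ) (x : ℝ), Complex.exp (Complex.I * ((t + j * h) * x : ℝ)) =
      Complex.exp (Complex.I * (t * x : ℝ)) * Complex.exp (Complex.I * (h * x : ℝ)) ^ j := by
    intro j x
    rw [← Complex.exp_nat_mul, ← Complex.exp_add]
    congr 1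
    push_cast
    ring
  have hI := fun j : ℕ => integrableOn_exp_mul hf (t + j * h)
  have hIc := fun j : ℕ => (hI j).const_mul (c j)
  have h1 : transform f (t + m * h) - ∑ j ∈ Finset.range N, c j * transform f (t + j * h) =
      ∫ x in Ω, (Complex.exp (Complex.I * ((t + m * h) * x : ℝ)) * f x -
        ∑ j ∈ Finset.range N, c j * (Complex.exp (Complex.I * ((t + j * h) * x : ℝ)) * f x)) := by
    rw [integral_sub (hI m) (integrable_finsetSum _ fun j _ => hIc j),
      integral_finsetSum _ fun j _ => hIc j]
    simp_rw [integral_const_mul]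
    rfl
  have h2 : ‖transform f (t + m * h) - ∑ j ∈ Finset.range N, c j * transform f (t + j * h)‖ ≤
      (1 / 2) ^ N * Real.exp (2 * (m * |h|)) * ∫ x in Ω, ‖f x‖ := by
    rw [h1, ← integral_const_mul]
    refine norm_integral_le_of_norm_le (hf.norm.const_mul _) ?_
    filter_upwards [ae_restrict_mem (measurableSet_Ioo : MeasurableSet Ω)] with x hx
    set z := Complex.exp (Complex.I * (h * x : ℝ)) with hzdef
    have h3 : Complex.exp (Complex.I * ((t + m * h) * x : ℝ)) * f x -
        ∑ j ∈ Finset.range N, c j * (Complex.exp (Complex.I * ((t + j * h) * x : ℝ)) * f x) =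
        Complex.exp (Complex.I * (t * x : ℝ)) *
          (z ^ m - ∑ j ∈ Finset.range N, c j * z ^ j) * f x := by
      simp_rw [hpow]
      rw [mul_sub, sub_mul, Finset.mul_sum, Finset.sum_mul]
      congr 1
      exact Finset.sum_congr rfl fun j _ => by ring
    rw [h3, norm_mul, norm_mul, norm_exp_I_mul_real, one_mul]
    have hx1 : |x| ≤ 1 := abs_le.2 ⟨hx.1.le, hx.2.le⟩
    have h4 : ‖z - 1‖ ≤ |h| := by
      refine Real.norm_exp_I_mul_ofReal_sub_one_le.trans ?_
      rw [Real.norm_eq_abs, abs_mul]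
      exact mul_le_of_le_one_right (abs_nonneg _) hx1
    gcongr
    refine (hz z).trans ?_
    gcongr
    calc (1 + 2 * ‖z - 1‖) ^ m ≤ Real.exp (2 * |h|) ^ m := by
          gcongr
          linarith [Real.add_one_le_exp (2 * |h|)]
      _ = _ := by rw [← Real.exp_nat_mul]; ring_nf
  calc _ = ‖∑ j ∈ Finset.range N, c j * transform f (t + j * h) + (transform f (t + m * h) -
        ∑ j ∈ Finset.range N, c j * transform f (t + j * h))‖ := by rw [add_sub_cancel]
    _ ≤ _ := by
      refine (norm_add_le _ _).trans (add_le_add ?_ h2)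
      rw [Finset.mul_sum]
      refine (norm_sum_le _ _).trans (Finset.sum_le_sum fun j _ => ?_)
      rw [norm_mul]
      gcongr
      exact hc j

/-- Square mean form of `norm_transform_add_mul_le`, over the cell `[mh, (m+1)h]`. The sign `σ`
selects positive or negative frequencies. -/
lemma integral_sq_transform_cell_le {f : ℝ → ℂ} (hf : MemL2 f) {σ : ℝ} (hσ : |σ| = 1)
    {h : ℝ} (hh : 0 < h) (m N : ℕ) :
    ∫ t in (m * h)..((m + 1 : ℕ) * h), ‖transform f (σ * t)‖ ^ 2 ≤
      2 * 9 ^ m * N * (∫ t in (0 : ℝ)..(N * h), ‖transform f (σ * t)‖ ^ 2) +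
      4 * h * (1 / 4) ^ N * Real.exp (4 * (m * h)) * l2NormSq f := by
  have hc := continuous_transform hf.integrable
  have hcell : ∀ j : ℕ, ∫ t in (j * h)..((j + 1 : ℕ) * h), ‖transform f (σ * t)‖ ^ 2 =
      ∫ t in (0 : ℝ)..h, ‖transform f (σ * t + j * (σ * h))‖ ^ 2 := by
    intro j
    have := intervalIntegral.integral_comp_add_right (a := 0) (b := h)
      (fun t => ‖transform f (σ * t)‖ ^ 2) (j * h)
    simp only [mul_add] at this
    rw [zero_add, show h + j * h = (j + 1 : ℕ) * h by push_cast; ring] at this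
    rw [← this]
    congr 1
    ext t
    ring_nf
  have hsum : ∑ j ∈ Finset.range N, ∫ t in (0 : ℝ)..h, ‖transform f (σ * t + j * (σ * h))‖ ^ 2 =
      ∫ t in (0 : ℝ)..(N * h), ‖transform f (σ * t)‖ ^ 2 := by
    simp_rw [← hcell]
    rw [intervalIntegral.sum_integral_adjacent_intervals (a := fun j : ℕ => (j : ℝ) * h)
      fun k _ => (by fun_prop : Continuous _).intervalIntegrable _ _]
    simp
  have hint : ∀ j : ℕ, IntervalIntegrable
      (fun t => ‖transform f (σ * t + j * (σ * h))‖ ^ 2) volume 0 h := fun j =>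
    (by fun_prop : Continuous _).intervalIntegrable _ _
  set A := ∫ x in Ω, ‖f x‖ with hA
  have hA2 : A ^ 2 ≤ 2 * l2NormSq f := sq_integral_norm_le hf
  have hpt : ∀ t, ‖transform f (σ * t + m * (σ * h))‖ ^ 2 ≤
      2 * 9 ^ m * N * (∑ j ∈ Finset.range N, ‖transform f (σ * t + j * (σ * h))‖ ^ 2) +
      4 * (1 / 4) ^ N * Real.exp (4 * (m * h)) * l2NormSq f := by
    intro t
    have h1 := norm_transform_add_mul_le hf.integrable (σ * t) (σ * h) m N
    rw [abs_mul, hσ, one_mul, abs_of_pos hh] at h1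
    set P := ∑ j ∈ Finset.range N, ‖transform f (σ * t + j * (σ * h))‖ with hP
    have h2 : P ^ 2 ≤ N * ∑ j ∈ Finset.range N, ‖transform f (σ * t + j * (σ * h))‖ ^ 2 := by
      simpa using sq_sum_le_card_mul_sum_sq (s := Finset.range N)
        (f := fun j : ℕ => ‖transform f (σ * t + j * (σ * h))‖)
    have h3 : ((1 / 2 : ℝ) ^ N * Real.exp (2 * (m * h)) * A) ^ 2 =
        (1 / 4) ^ N * Real.exp (4 * (m * h)) * A ^ 2 := by
      rw [mul_pow, mul_pow, ← pow_mul, mul_comm N 2, pow_mul, ← Real.exp_nat_mul,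
        show ((1 / 2 : ℝ) ^ 2) = 1 / 4 by norm_num]
      push_cast
      ring_nf
    calc _ ≤ (3 ^ m * P + (1 / 2) ^ N * Real.exp (2 * (m * h)) * A) ^ 2 := by gcongr
      _ ≤ 2 * ((3 ^ m * P) ^ 2 + ((1 / 2) ^ N * Real.exp (2 * (m * h)) * A) ^ 2) := add_sq_le
      _ = 2 * 9 ^ m * P ^ 2 + 2 * ((1 / 4) ^ N * Real.exp (4 * (m * h))) * A ^ 2 := by
          rw [h3, mul_pow, ← pow_mul, mul_comm m 2, pow_mul]
          norm_num
          ring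
      _ ≤ 2 * 9 ^ m * (N * ∑ j ∈ Finset.range N, ‖transform f (σ * t + j * (σ * h))‖ ^ 2) +
          2 * ((1 / 4) ^ N * Real.exp (4 * (m * h))) * (2 * l2NormSq f) := by gcongr
      _ = _ := by ring
  have hint' : IntervalIntegrable (fun t => ∑ j ∈ Finset.range N,
      ‖transform f (σ * t + j * (σ * h))‖ ^ 2) volume 0 h :=
    (by fun_prop : Continuous _).intervalIntegrable _ _
  rw [hcell]
  calc _ ≤ ∫ t in (0 : ℝ)..h, (2 * 9 ^ m * N * (∑ j ∈ Finset.range N,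
        ‖transform f (σ * t + j * (σ * h))‖ ^ 2) +
        4 * (1 / 4) ^ N * Real.exp (4 * (m * h)) * l2NormSq f) :=
        intervalIntegral.integral_mono_on hh.le (hint m)
          ((hint'.const_mul _).add intervalIntegrable_const) fun t _ => hpt t
    _ = _ := by
      rw [intervalIntegral.integral_add (hint'.const_mul _) intervalIntegrable_const,
        intervalIntegral.integral_const_mul, intervalIntegral.integral_finsetSum fun j _ => hint j,
        hsum, intervalIntegral.integral_const, smul_eq_mul]
      ring

/-- Quantitative unique continuation: the energy of the transform at frequencies up to `s` is
controlled by the energy at frequencies up to `1`, with an exponentially small error. -/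
lemma integral_sq_transform_le {f : ℝ → ℂ} (hf : MemL2 f) {σ : ℝ} (hσ : |σ| = 1)
    {s : ℝ} (hs : 1 ≤ s) :
    ∫ t in (0 : ℝ)..s, ‖transform f (σ * t)‖ ^ 2 ≤
      180 * Real.exp (33 * s ^ 2) * (∫ t in (0 : ℝ)..1, ‖transform f (σ * t)‖ ^ 2) +
      8 * s * Real.exp (-4 * s) * l2NormSq f := by
  have hc := continuous_transform hf.integrable
  have hl := l2NormSq_nonneg f
  have hii : ∀ a b, IntervalIntegrable (fun t => ‖transform f (σ * t)‖ ^ 2) volume a b :=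
    fun a b => (by fun_prop : Continuous _).intervalIntegrable _ _
  set D := ∫ t in (0 : ℝ)..1, ‖transform f (σ * t)‖ ^ 2 with hD
  have hD0 : 0 ≤ D := intervalIntegral.integral_nonneg zero_le_one fun _ _ => by positivity
  set N := ⌈8 * s⌉₊ with hN
  have hN1 : 8 * s ≤ N := Nat.le_ceil _
  have hN2 : (N : ℝ) ≤ 9 * s := by
    have := (Nat.ceil_lt_add_one (by positivity : 0 ≤ 8 * s)).le
    linarith
  have hNpos : (0 : ℝ) < N := by linarith
  set L := ⌈s * N⌉₊ with hL
  have hL1 : s * N ≤ L := Nat.le_ceil _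
  have hL3 : (L : ℝ) ≤ s * N + 1 := (Nat.ceil_lt_add_one (by positivity)).le
  have hL2 : (L : ℝ) ≤ 10 * s ^ 2 := by nlinarith
  set h : ℝ := (N : ℝ)⁻¹ with hh
  have hhpos : 0 < h := inv_pos.2 hNpos
  have hNh : N * h = 1 := mul_inv_cancel₀ hNpos.ne'
  have hsL : s ≤ L * h := by
    calc s = s * N * h := by rw [mul_assoc, hNh, mul_one]
      _ ≤ _ := by gcongr
  have hLh : L * h ≤ 2 * s := by
    calc L * h ≤ (s * N + 1) * h := by gcongr
      _ = s + h := by rw [add_mul, mul_assoc, hNh]; ring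
      _ ≤ 2 * s := by
        have : h ≤ 1 := inv_le_one_of_one_le₀ (by linarith)
        linarith
  have hmh : ∀ m ∈ Finset.range L, m * h ≤ s := by
    intro m hm
    have h1 : (m : ℝ) < s * N := Nat.lt_ceil.1 (Finset.mem_range.1 hm)
    calc m * h ≤ s * N * h := by gcongr
      _ = s := by rw [mul_assoc, hNh, mul_one]
  have hexp : (9 : ℝ) ^ L ≤ Real.exp (30 * s ^ 2) := by
    have h9 : (9 : ℝ) ≤ Real.exp 3 := by
      have he := Real.exp_one_gt_d9
      have : Real.exp 3 = Real.exp 1 ^ 3 := by rw [← Real.exp_nat_mul]; norm_num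
      rw [this]
      calc (9 : ℝ) ≤ 2.5 ^ 3 := by norm_num
        _ ≤ _ := by gcongr; linarith
    calc (9 : ℝ) ^ L ≤ Real.exp 3 ^ L := by gcongr
      _ = Real.exp (L * 3) := by rw [Real.exp_nat_mul]
      _ ≤ _ := Real.exp_le_exp.2 (by linarith)
  have hquarter : (1 / 4 : ℝ) ^ N * Real.exp (4 * s) ≤ Real.exp (-4 * s) := by
    have h4 : (1 / 4 : ℝ) ≤ Real.exp (-1) := by
      rw [Real.exp_neg, one_div]
      gcongr
      linarith [Real.exp_one_lt_d9]
    calc (1 / 4 : ℝ) ^ N * Real.exp (4 * s) ≤ Real.exp (-1) ^ N * Real.exp (4 * s) := by gcongr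
      _ = Real.exp (-N + 4 * s) := by rw [← Real.exp_nat_mul, ← Real.exp_add]; ring_nf
      _ ≤ _ := by gcongr; linarith
  have hs3 : s ^ 3 ≤ Real.exp (3 * s ^ 2) := by
    have : s ≤ Real.exp (s ^ 2) := by nlinarith [Real.add_one_le_exp (s ^ 2)]
    calc s ^ 3 ≤ Real.exp (s ^ 2) ^ 3 := by gcongr
      _ = _ := by rw [← Real.exp_nat_mul]; norm_num
  calc ∫ t in (0 : ℝ)..s, ‖transform f (σ * t)‖ ^ 2
      ≤ ∫ t in (0 : ℝ)..(L * h), ‖transform f (σ * t)‖ ^ 2 :=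
        intervalIntegral.integral_mono_interval le_rfl (by linarith) hsL
          (.of_forall fun _ => by positivity) (hii _ _)
    _ = ∑ m ∈ Finset.range L,
          ∫ t in (m * h)..((m + 1 : ℕ) * h), ‖transform f (σ * t)‖ ^ 2 := by
        rw [intervalIntegral.sum_integral_adjacent_intervals (a := fun j : ℕ => (j : ℝ) * h)
          fun k _ => hii _ _]
        simp
    _ ≤ ∑ m ∈ Finset.range L, (2 * 9 ^ L * N * D +
          4 * h * (Real.exp (-4 * s)) * l2NormSq f) := by
        refine Finset.sum_le_sum fun m hm => ?_
        refine (integral_sq_transform_cell_le hf hσ hhpos m N).trans ?_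
        rw [hNh, ← hD]
        have h1 : (1 / 4 : ℝ) ^ N * Real.exp (4 * (m * h)) ≤ Real.exp (-4 * s) := by
          refine le_trans ?_ hquarter
          gcongr
          exact hmh m hm
        have h2 : (9 : ℝ) ^ m ≤ 9 ^ L :=
          pow_le_pow_right₀ (by norm_num) (Finset.mem_range.1 hm).le
        rw [mul_assoc (4 * h)]
        gcongr
    _ = 2 * (L * N * 9 ^ L) * D + 4 * (L * h) * Real.exp (-4 * s) * l2NormSq f := by
        rw [Finset.sum_const, Finset.card_range, nsmul_eq_mul]
        ring
    _ ≤ 2 * (10 * s ^ 2 * (9 * s) * Real.exp (30 * s ^ 2)) * D +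
          4 * (2 * s) * Real.exp (-4 * s) * l2NormSq f := by gcongr
    _ = 180 * (s ^ 3 * Real.exp (30 * s ^ 2)) * D + 8 * s * Real.exp (-4 * s) * l2NormSq f := by
        ring
    _ ≤ 180 * (Real.exp (3 * s ^ 2) * Real.exp (30 * s ^ 2)) * D +
          8 * s * Real.exp (-4 * s) * l2NormSq f := by gcongr
    _ = _ := by rw [← Real.exp_add]; ring_nf

/-! ### Integration by parts for weak derivatives -/

/-- For `σ = ±1`, a smooth step of width `1 / n` near the end point `-σ`: it is `0` within distance
`1 / n` of that end point and `1` beyond distance `2 / n`. -/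
noncomputable def ramp (σ : ℝ) (n : ℕ) (x : ℝ) : ℝ :=
  Real.smoothTransition (n * (1 + σ * x) - 1)

/-- The derivative of `ramp σ n` up to the sign `σ`: an approximate unit mass at the end
point `-σ`. -/
noncomputable def peak (σ : ℝ) (n : ℕ) (x : ℝ) : ℝ :=
  n * deriv Real.smoothTransition (n * (1 + σ * x) - 1)

/-- A smooth cutoff supported inside the domain. The two ramps overlap where both are `1`, so their
sum less `1` acts as a product, with a simpler derivative. -/
noncomputable def cutoff (n : ℕ) (x : ℝ) : ℝ := ramp 1 n x + ramp (-1) n x - 1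

lemma contDiff_ramp (σ : ℝ) (n : ℕ) : ContDiff ℝ ∞ (ramp σ n) :=
  Real.smoothTransition.contDiff.comp (by fun_prop)

lemma contDiff_cutoff (n : ℕ) : ContDiff ℝ ∞ (cutoff n) :=
  ((contDiff_ramp 1 n).add (contDiff_ramp (-1) n)).sub contDiff_const

lemma hasDerivAt_ramp (σ : ℝ) (n : ℕ) (x : ℝ) :
    HasDerivAt (ramp σ n) (σ * peak σ n x) x := by
  have h1 : HasDerivAt Real.smoothTransition
      (deriv Real.smoothTransition (n * (1 + σ * x) - 1)) (n * (1 + σ * x) - 1) :=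
    ((Real.smoothTransition.contDiff (n := 1)).differentiable (by simp) _).hasDerivAt
  have h2 : HasDerivAt (fun x : ℝ => (n : ℝ) * (1 + σ * x) - 1) (n * (σ * 1)) x :=
    ((((hasDerivAt_id x).const_mul σ).const_add 1).const_mul (n : ℝ)).sub_const 1
  refine (h1.comp x h2).congr_deriv ?_
  rw [peak]
  ring

lemma deriv_cutoff (n : ℕ) (x : ℝ) : deriv (cutoff n) x = peak 1 n x - peak (-1) n x := by
  have h := (((hasDerivAt_ramp 1 n x).add (hasDerivAt_ramp (-1) n x)).sub_const 1).deriv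
  rw [show cutoff n = fun x => (ramp 1 n + ramp (-1) n) x - 1 from rfl, h]
  ring

lemma continuous_peak (σ : ℝ) (n : ℕ) : Continuous (peak σ n) := by
  have := (Real.smoothTransition.contDiff (n := 1)).continuous_deriv le_rfl
  unfold peak
  fun_prop

lemma peak_nonneg (σ : ℝ) (n : ℕ) (x : ℝ) : 0 ≤ peak σ n x :=
  mul_nonneg n.cast_nonneg Real.smoothTransition.monotone.deriv_nonneg

lemma peak_eq_zero {σ : ℝ} {n : ℕ} {x : ℝ} (h : 2 < n * (1 + σ * x)) : peak σ n x = 0 := by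
  have h1 : Real.smoothTransition =ᶠ[nhds (n * (1 + σ * x) - 1)] fun _ => 1 := by
    filter_upwards [lt_mem_nhds (by linarith : (1 : ℝ) < n * (1 + σ * x) - 1)] with y hy
    exact Real.smoothTransition.one_of_one_le hy.le
  rw [peak, h1.deriv_eq, deriv_const, mul_zero]

lemma integral_peak {σ : ℝ} (hσ : σ = 1 ∨ σ = -1) {n : ℕ} (hn : 1 ≤ n) :
    ∫ x in Ω, peak σ n x = 1 := by
  have hn' : (1 : ℝ) ≤ n := by exact_mod_cast hn
  have h0 : ∫ x in Ω, peak σ n x = ∫ x in (-1 : ℝ)..1, peak σ n x := by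
    rw [intervalIntegral.integral_of_le (by norm_num), integral_Ioc_eq_integral_Ioo, Ω]
  have h1 : ∫ x in (-1 : ℝ)..1, σ * peak σ n x = ramp σ n 1 - ramp σ n (-1) :=
    intervalIntegral.integral_eq_sub_of_hasDerivAt (fun x _ => hasDerivAt_ramp σ n x)
      ((continuous_const.mul (continuous_peak σ n)).intervalIntegrable _ _)
  rw [intervalIntegral.integral_const_mul] at h1
  have hone : Real.smoothTransition (n * (1 + 1) - 1) = 1 :=
    Real.smoothTransition.one_of_one_le (by linarith)
  have hzero : Real.smoothTransition (n * (1 - 1) - 1) = 0 :=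
    Real.smoothTransition.zero_of_nonpos (by linarith)
  rw [h0]
  rcases hσ with rfl | rfl
  · have ha : ramp 1 n 1 = 1 := by rw [ramp, mul_one, hone]
    have hb : ramp 1 n (-1) = 0 := by rw [ramp, ← hzero]; ring_nf
    linarith
  · have ha : ramp (-1) n 1 = 0 := by rw [ramp, ← hzero]; ring_nf
    have hb : ramp (-1) n (-1) = 1 := by rw [ramp, neg_one_mul, neg_neg, hone]
    linarith

lemma tendsto_integral_peak_smul {σ : ℝ} (hσ : σ = 1 ∨ σ = -1) {G : ℝ → ℂ}
    (hG : ContinuousOn G (Icc (-1) 1)) :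
    Filter.Tendsto (fun n : ℕ => ∫ x in Ω, peak σ n x • G x) Filter.atTop (nhds (G (-σ))) := by
  have hsub : Ω ⊆ Icc (-1) 1 := Ioo_subset_Icc_self
  have hmem : -σ ∈ Icc (-1 : ℝ) 1 := by rcases hσ with rfl | rfl <;> norm_num
  have hGi : IntegrableOn G Ω := (hG.integrableOn_compact isCompact_Icc).mono_set hsub
  refine tendsto_setIntegral_peak_smul_of_integrableOn_of_tendsto
    (measurableSet_Ioo : MeasurableSet Ω) (measurableSet_Ioo : MeasurableSet Ω) subset_rfl
    self_mem_nhdsWithin (by simp) (.of_forall fun n x _ => peak_nonneg σ n x)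
    (fun U hU hmU => ?_) ?_
    (.of_forall fun n => (continuous_peak σ n).aestronglyMeasurable) hGi
    ((hG _ hmem).mono_left (nhdsWithin_mono _ hsub))
  · obtain ⟨δ, hδ, hball⟩ := Metric.isOpen_iff.1 hU _ hmU
    obtain ⟨n₀, hn₀⟩ := exists_nat_gt (2 / δ)
    refine Metric.tendstoUniformlyOn_iff.2 fun ε hε => ?_
    filter_upwards [Filter.eventually_ge_atTop n₀] with n hn x hx
    have hd : δ ≤ 1 + σ * x := by
      have h1 : δ ≤ |x - -σ| := by
        by_contra hlt
        exact hx.2 (hball (by simpa [Real.dist_eq] using hlt))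
      have hx' := hx.1
      rcases hσ with rfl | rfl
      · rw [abs_of_nonneg (by linarith [hx'.1])] at h1; linarith
      · rw [abs_of_nonpos (by linarith [hx'.2])] at h1; linarith
    have h2 : 2 < n * (1 + σ * x) := by
      have hn' : (n₀ : ℝ) ≤ n := by exact_mod_cast hn
      calc 2 < n₀ * δ := (div_lt_iff₀ hδ).1 hn₀
        _ ≤ n * (1 + σ * x) := by gcongr
    simpa [peak_eq_zero h2] using hε
  · refine tendsto_const_nhds.congr' ?_
    filter_upwards [Filter.eventually_ge_atTop 1] with n hn
    exact (integral_peak hσ hn).symm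

lemma abs_cutoff_le (n : ℕ) (x : ℝ) : |cutoff n x| ≤ 1 := by
  unfold cutoff ramp
  rw [abs_le]
  constructor <;>
  linarith [Real.smoothTransition.nonneg (n * (1 + 1 * x) - 1),
    Real.smoothTransition.nonneg (n * (1 + -1 * x) - 1),
    Real.smoothTransition.le_one (n * (1 + 1 * x) - 1),
    Real.smoothTransition.le_one (n * (1 + -1 * x) - 1)]

lemma tendsto_cutoff {x : ℝ} (hx : x ∈ Ω) :
    Filter.Tendsto (fun n => cutoff n x) Filter.atTop (nhds 1) := by
  have h : ∀ t : ℝ, 0 < t → ∀ᶠ n : ℕ in Filter.atTop,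
      Real.smoothTransition (n * t - 1) = 1 := by
    intro t ht
    have h1 : Filter.Tendsto (fun n : ℕ => (n : ℝ) * t) Filter.atTop Filter.atTop :=
      tendsto_natCast_atTop_atTop.atTop_mul_const ht
    filter_upwards [h1.eventually_ge_atTop 2] with n hn
    exact Real.smoothTransition.one_of_one_le (by linarith)
  refine tendsto_const_nhds.congr' ?_
  filter_upwards [h (1 + 1 * x) (by linarith [hx.1]), h (1 + -1 * x) (by linarith [hx.2])]
    with n h1 h2
  rw [cutoff, ramp, ramp, h1, h2]
  norm_num

lemma support_cutoff_subset {n : ℕ} (hn : 2 ≤ n) :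
    Function.support (cutoff n) ⊆ Icc (-1 + 1 / (n : ℝ)) (1 - 1 / n) := by
  have hn' : (2 : ℝ) ≤ n := by exact_mod_cast hn
  have hpos : (0 : ℝ) < n := by linarith
  intro x hx
  by_contra hx'
  refine hx ?_
  have hcase : n * (1 + x) ≤ 1 ∨ n * (1 - x) ≤ 1 := by
    by_contra! hcon
    refine hx' ⟨?_, ?_⟩
    · have := (div_le_iff₀' hpos).2 hcon.1.le; linarith
    · have := (div_le_iff₀' hpos).2 hcon.2.le; linarith
  rw [cutoff, ramp, ramp, one_mul, neg_one_mul, ← sub_eq_add_neg]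
  rcases hcase with h | h
  · rw [Real.smoothTransition.zero_of_nonpos (by linarith),
      Real.smoothTransition.one_of_one_le (by nlinarith)]
    norm_num
  · rw [Real.smoothTransition.one_of_one_le (by nlinarith),
      Real.smoothTransition.zero_of_nonpos (by linarith)]
    norm_num

lemma tsupport_cutoff_subset {n : ℕ} (hn : 2 ≤ n) :
    tsupport (cutoff n) ⊆ Icc (-1 + 1 / (n : ℝ)) (1 - 1 / n) :=
  closure_minimal (support_cutoff_subset hn) isClosed_Icc

lemma integrableOn_continuous_smul {ψ : ℝ → ℝ} (hψ : Continuous ψ) {k : ℝ → ℂ}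
    (hk : IntegrableOn k Ω) : IntegrableOn (fun x => ψ x • k x) Ω := by
  obtain ⟨C, hC⟩ := isCompact_Icc.exists_bound_of_continuousOn (s := Icc (-1 : ℝ) 1)
    hψ.continuousOn
  refine Integrable.bdd_smul hk (C := C) hψ.aestronglyMeasurable ?_
  filter_upwards [ae_restrict_mem (measurableSet_Ioo : MeasurableSet Ω)] with x hx
  exact hC x (Ioo_subset_Icc_self hx)

lemma tendsto_integral_cutoff_smul {k : ℝ → ℂ} (hk : IntegrableOn k Ω) :
    Filter.Tendsto (fun n => ∫ x in Ω, cutoff n x • k x) Filter.atTop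
      (nhds (∫ x in Ω, k x)) := by
  refine tendsto_integral_of_dominated_convergence (fun x => ‖k x‖)
    (fun n => (integrableOn_continuous_smul (contDiff_cutoff n).continuous hk).1) hk.norm
    (fun n => .of_forall fun x => ?_) ?_
  · rw [norm_smul]
    exact mul_le_of_le_one_left (norm_nonneg _) (abs_cutoff_le n x)
  · filter_upwards [ae_restrict_mem (measurableSet_Ioo : MeasurableSet Ω)] with x hx
    simpa using (tendsto_cutoff hx).smul_const (k x)

/-- Integration by parts against a smooth function that need not vanish at the end points: the
boundary term is whatever the derivatives of the cutoffs produce in the limit. -/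
lemma HasWeakDeriv.integral_add_integral {u v : ℝ → ℂ} (h : HasWeakDeriv u v)
    (hu : IntegrableOn u Ω) (hv : IntegrableOn v Ω) {ψ : ℝ → ℝ} (hψ : ContDiff ℝ ∞ ψ) {B : ℂ}
    (hB : Filter.Tendsto (fun n => ∫ x in Ω, deriv (cutoff n) x • (ψ x • u x)) Filter.atTop
      (nhds B)) :
    ∫ x in Ω, deriv ψ x • u x + ψ x • v x = -B := by
  have hψ' : Continuous (deriv ψ) := hψ.continuous_deriv (by simp)
  have hiu := integrableOn_continuous_smul hψ.continuous hu
  have hiu' := integrableOn_continuous_smul hψ' hu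
  have hiv := integrableOn_continuous_smul hψ.continuous hv
  have hlim := hB.add (tendsto_integral_cutoff_smul (hiu'.add hiv))
  have hzero : ∀ n ≥ 2, (∫ x in Ω, deriv (cutoff n) x • (ψ x • u x)) +
      ∫ x in Ω, cutoff n x • ((fun x => deriv ψ x • u x) + fun x => ψ x • v x) x = 0 := by
    intro n hn
    have hχ := contDiff_cutoff n
    have hχ' : Continuous (deriv (cutoff n)) := hχ.continuous_deriv (by simp)
    have hts : tsupport (cutoff n * ψ) ⊆ Icc (-1 + 1 / (n : ℝ)) (1 - 1 / n) :=
      (closure_mono (Function.support_mul_subset_left _ _)).trans (tsupport_cutoff_subset hn)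
    have hpos : (0 : ℝ) < 1 / n := by positivity
    have key := h.integral_eq (cutoff n * ψ) (hχ.mul hψ)
      (isCompact_Icc.of_isClosed_subset (isClosed_tsupport _) hts)
      (hts.trans fun x hx => ⟨by linarith [hx.1], by linarith [hx.2]⟩)
    have hd : ∀ x, deriv (cutoff n * ψ) x • u x =
        deriv (cutoff n) x • (ψ x • u x) + cutoff n x • (deriv ψ x • u x) := by
      intro x
      rw [deriv_mul (hχ.differentiable (by simp) x) (hψ.differentiable (by simp) x)]
      simp only [smul_smul, add_smul]
    simp_rw [hd] at key
    rw [integral_add (integrableOn_continuous_smul hχ' hiu)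
      (integrableOn_continuous_smul hχ.continuous hiu')] at key
    simp only [Pi.add_apply, smul_add, Pi.mul_apply, mul_smul] at key ⊢
    rw [integral_add (integrableOn_continuous_smul hχ.continuous hiu')
      (integrableOn_continuous_smul hχ.continuous hiv), ← add_assoc, key, neg_add_cancel]
  have h0 := tendsto_nhds_unique hlim (tendsto_const_nhds.congr' (by
    filter_upwards [Filter.eventually_ge_atTop 2] with n hn
    exact (hzero n hn).symm))
  exact (neg_eq_of_add_eq_zero_right h0).symm

/-- Integration by parts with boundary values, for a function continuous up to the boundary. -/
lemma HasWeakDeriv.integral_eq_boundary {u v : ℝ → ℂ} (h : HasWeakDeriv u v)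
    (hu : ContinuousOn u (Icc (-1) 1)) (hv : IntegrableOn v Ω) {ψ : ℝ → ℝ}
    (hψ : ContDiff ℝ ∞ ψ) :
    ∫ x in Ω, deriv ψ x • u x + ψ x • v x = ψ 1 • u 1 - ψ (-1) • u (-1) := by
  have hG : ContinuousOn (fun x => ψ x • u x) (Icc (-1) 1) := hψ.continuous.continuousOn.smul hu
  have hGi : IntegrableOn (fun x => ψ x • u x) Ω :=
    (hG.integrableOn_compact isCompact_Icc).mono_set Ioo_subset_Icc_self
  have hB := (tendsto_integral_peak_smul (Or.inl rfl) hG).sub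
    (tendsto_integral_peak_smul (Or.inr rfl) hG)
  rw [h.integral_add_integral
    ((hu.integrableOn_compact isCompact_Icc).mono_set Ioo_subset_Icc_self) hv hψ
    (B := ψ (-1) • u (-1) - ψ 1 • u 1) ?_, neg_sub]
  rw [neg_neg] at hB
  refine hB.congr fun n => ?_
  rw [← integral_sub (integrableOn_continuous_smul (continuous_peak _ n) hGi)
    (integrableOn_continuous_smul (continuous_peak _ n) hGi)]
  simp_rw [deriv_cutoff, sub_smul]

/-- The derivatives of the cutoffs eventually live outside any compact subset of the domain, so
there is no boundary term for a function supported inside. -/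
lemma HasWeakDeriv.integral_eq_zero_of_supportedInside {u v : ℝ → ℂ} (h : HasWeakDeriv u v)
    (hs : SupportedInside u) (hu : IntegrableOn u Ω) (hv : IntegrableOn v Ω) {ψ : ℝ → ℝ}
    (hψ : ContDiff ℝ ∞ ψ) :
    ∫ x in Ω, deriv ψ x • u x + ψ x • v x = 0 := by
  obtain ⟨S, hS, hSΩ, hzero⟩ := hs
  rw [h.integral_add_integral hu hv hψ (B := 0) ?_, neg_zero]
  obtain ⟨δ, hδ, hδS⟩ : ∃ δ > 0, ∀ x ∈ S, δ ≤ 1 + x ∧ δ ≤ 1 - x := by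
    rcases S.eq_empty_or_nonempty with rfl | hne
    · exact ⟨1, one_pos, fun x hx => hx.elim⟩
    · obtain ⟨x₀, hx₀, hmin⟩ := hS.exists_isMinOn hne
        (f := fun x : ℝ => min (1 + x) (1 - x)) (by fun_prop)
      have hx₀' := hSΩ hx₀
      refine ⟨min (1 + x₀) (1 - x₀), lt_min (by linarith [hx₀'.1]) (by linarith [hx₀'.2]),
        fun x hx => le_min_iff.1 (isMinOn_iff.1 hmin x hx)⟩
  obtain ⟨n₀, hn₀⟩ := exists_nat_gt (2 / δ)
  refine tendsto_const_nhds.congr' ?_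
  filter_upwards [Filter.eventually_ge_atTop n₀] with n hn
  refine (integral_eq_zero_of_ae ?_).symm
  filter_upwards [hzero] with x hx
  by_cases hxS : x ∈ S
  · have hn' : (n₀ : ℝ) ≤ n := by exact_mod_cast hn
    have h2 : ∀ y, δ ≤ y → 2 < n * y := fun y hy =>
      calc 2 < n₀ * δ := (div_lt_iff₀ hδ).1 hn₀
        _ ≤ n * y := by gcongr
    rw [deriv_cutoff, peak_eq_zero (h2 _ (by linarith [(hδS x hxS).1])),
      peak_eq_zero (h2 _ (by linarith [(hδS x hxS).2]))]
    simp
  · simp [hx hxS]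

/-! ### The transform of a weak derivative and the boundary data -/

lemma deriv_cos_mul (ξ : ℝ) :
    deriv (fun x => Real.cos (ξ * x)) = fun x => -ξ * Real.sin (ξ * x) := by
  ext x
  have h := ((hasDerivAt_id x).const_mul ξ).cos.deriv
  simp only [id, mul_one] at h
  rw [h]
  ring

lemma deriv_sin_mul (ξ : ℝ) :
    deriv (fun x => Real.sin (ξ * x)) = fun x => ξ * Real.cos (ξ * x) := by
  ext x
  have h := ((hasDerivAt_id x).const_mul ξ).sin.deriv
  simp only [id, mul_one] at h
  rw [h]
  ring

lemma transform_eq_cos_add_sin {f : ℝ → ℂ} (hf : IntegrableOn f Ω) (ξ : ℝ) :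
    transform f ξ = (∫ x in Ω, Real.cos (ξ * x) • f x) +
      Complex.I * ∫ x in Ω, Real.sin (ξ * x) • f x := by
  have h1 := integrableOn_continuous_smul (ψ := fun x => Real.cos (ξ * x)) (by fun_prop) hf
  have h2 := integrableOn_continuous_smul (ψ := fun x => Real.sin (ξ * x)) (by fun_prop) hf
  rw [← integral_const_mul, ← integral_add h1 (h2.const_mul _), transform]
  refine integral_congr_ae (.of_forall fun x => ?_)
  simp only [Complex.real_smul]
  rw [mul_comm Complex.I, Complex.exp_mul_I, ← Complex.ofReal_cos, ← Complex.ofReal_sin]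
  ring

lemma HasWeakDeriv.transform_eq {f g : ℝ → ℂ} (h : HasWeakDeriv f g) (hs : SupportedInside f)
    (hf : IntegrableOn f Ω) (hg : IntegrableOn g Ω) (ξ : ℝ) :
    transform g ξ = -(Complex.I * ξ) * transform f ξ := by
  have hc : ContDiff ℝ ∞ fun x => Real.cos (ξ * x) := by fun_prop
  have hs' : ContDiff ℝ ∞ fun x => Real.sin (ξ * x) := by fun_prop
  have i1 : ∀ k : ℝ → ℂ, IntegrableOn k Ω → IntegrableOn (fun x => Real.cos (ξ * x) • k x) Ω :=
    fun k hk => integrableOn_continuous_smul (by fun_prop) hk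
  have i2 : ∀ k : ℝ → ℂ, IntegrableOn k Ω → IntegrableOn (fun x => Real.sin (ξ * x) • k x) Ω :=
    fun k hk => integrableOn_continuous_smul (by fun_prop) hk
  have e1 := h.integral_eq_zero_of_supportedInside hs hf hg hc
  have e2 := h.integral_eq_zero_of_supportedInside hs hf hg hs'
  simp only [deriv_cos_mul, deriv_sin_mul, mul_smul] at e1 e2
  have a1 := integral_add ((i2 f hf).smul (-ξ)) (i1 g hg)
  have a2 := integral_add ((i1 f hf).smul ξ) (i2 g hg)
  simp only [Pi.smul_apply] at a1 a2
  rw [a1, integral_smul, Complex.real_smul, Complex.ofReal_neg] at e1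
  rw [a2, integral_smul, Complex.real_smul] at e2
  rw [transform_eq_cos_add_sin hg, transform_eq_cos_add_sin hf]
  clear a1 a2
  generalize (∫ x in Ω, Real.sin (ξ * x) • f x) = sf at *
  generalize (∫ x in Ω, Real.cos (ξ * x) • f x) = cf at *
  generalize (∫ x in Ω, Real.sin (ξ * x) • g x) = sg at *
  generalize (∫ x in Ω, Real.cos (ξ * x) • g x) = cg at *
  linear_combination e1 + Complex.I * e2 + ξ * sf * Complex.I_sq

/-- Green's identity for the equation `u'' + k² u = f`, given with `v = u'` and `w = u''`. -/
lemma integral_smul_source_eq {k : ℝ} {f u v w : ℝ → ℂ} (hu : ContinuousOn u (Icc (-1) 1))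
    (hv : ContinuousOn v (Icc (-1) 1)) (hw : IntegrableOn w Ω) (huv : HasWeakDeriv u v)
    (hvw : HasWeakDeriv v w) (heq : ∀ᵐ x ∂(volume.restrict Ω), w x + (k : ℂ) ^ 2 * u x = f x)
    {ψ : ℝ → ℝ} (hψ : ContDiff ℝ ∞ ψ) (hψ2 : ∀ x, deriv (deriv ψ) x = -k ^ 2 * ψ x) :
    ∫ x in Ω, ψ x • f x = (ψ 1 • v 1 - ψ (-1) • v (-1)) -
      (deriv ψ 1 • u 1 - deriv ψ (-1) • u (-1)) := by
  have hψ' : ContDiff ℝ ∞ (deriv ψ) := (contDiff_infty_iff_deriv.1 hψ).2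
  have hψ'' : Continuous (deriv (deriv ψ)) := hψ'.continuous_deriv (by simp)
  have hui := (hu.integrableOn_compact (μ := volume) isCompact_Icc).mono_set
    (Ioo_subset_Icc_self : Ω ⊆ _)
  have hvi := (hv.integrableOn_compact (μ := volume) isCompact_Icc).mono_set
    (Ioo_subset_Icc_self : Ω ⊆ _)
  have i1 := integrableOn_continuous_smul hψ'' hui
  have i2 := integrableOn_continuous_smul hψ'.continuous hvi
  have i3 := integrableOn_continuous_smul hψ.continuous hw
  rw [← hvw.integral_eq_boundary hv hw hψ, ← huv.integral_eq_boundary hu hvi hψ',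
    ← integral_sub (f := fun x => deriv ψ x • v x + ψ x • w x)
      (g := fun x => deriv (deriv ψ) x • u x + deriv ψ x • v x) (i2.add i3) (i1.add i2)]
  refine integral_congr_ae ?_
  filter_upwards [heq] with x hx
  rw [← hx, hψ2]
  simp only [Complex.real_smul]
  push_cast
  ring

lemma IsOutgoingSolution.transform_eq {k : ℝ} {f u : ℝ → ℂ} (hf : IntegrableOn f Ω)
    (h : IsOutgoingSolution k f u) :
    transform f k = -2 * k * Complex.I * Complex.exp (k * Complex.I) * u 1 ∧
      transform f (-k) = -2 * k * Complex.I * Complex.exp (k * Complex.I) * u (-1) := by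
  obtain ⟨v, w, hu, hv, hw, huv, hvw, heq, hb1, hb2⟩ := h
  have hv1 : v 1 = -(Complex.I * k * u 1) := eq_neg_of_add_eq_zero_left hb1
  have hv2 : v (-1) = Complex.I * k * u (-1) := sub_eq_zero.1 hb2
  have key : ∀ ξ : ℝ, ξ ^ 2 = k ^ 2 → transform f ξ =
      (Complex.cos ξ * v 1 + ξ * Complex.sin ξ * u 1) -
        (Complex.cos ξ * v (-1) - ξ * Complex.sin ξ * u (-1)) +
      Complex.I * ((Complex.sin ξ * v 1 - ξ * Complex.cos ξ * u 1) +
        (Complex.sin ξ * v (-1) + ξ * Complex.cos ξ * u (-1))) := by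
    intro ξ hξ
    have e1 := integral_smul_source_eq hu hv (MemL2.integrable hw) huv hvw heq
      (ψ := fun x => Real.cos (ξ * x)) (by fun_prop) (fun x => by
        rw [deriv_cos_mul, deriv_const_mul_field, deriv_sin_mul, ← hξ]; ring)
    have e2 := integral_smul_source_eq hu hv (MemL2.integrable hw) huv hvw heq
      (ψ := fun x => Real.sin (ξ * x)) (by fun_prop) (fun x => by
        rw [deriv_sin_mul, deriv_const_mul_field, deriv_cos_mul, ← hξ]; ring)
    rw [transform_eq_cos_add_sin hf, e1, e2, deriv_cos_mul, deriv_sin_mul]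
    simp only [Complex.real_smul, mul_one, mul_neg, Real.cos_neg, Real.sin_neg]
    push_cast
    ring
  rw [Complex.exp_mul_I, key k rfl, key (-k) (by ring), hv1, hv2]
  push_cast
  rw [Complex.cos_neg, Complex.sin_neg]
  constructor <;> ring_nf <;> simp only [Complex.I_sq] <;> ring

lemma dataDensity_eq {f : ℝ → ℂ} (hf : IntegrableOn f Ω) {u : ℝ → ℝ → ℂ} {α : ℝ}
    (h : IsOutgoingSolution α f fun x => u x α) :
    dataDensity u α = 1 / 4 * (‖transform f α‖ ^ 2 + ‖transform f (-α)‖ ^ 2) := by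
  obtain ⟨h1, h2⟩ := h.transform_eq hf
  rw [h1, h2, dataDensity]
  simp only [norm_mul, norm_neg, Complex.norm_I, Complex.norm_exp_ofReal_mul_I, Complex.norm_real,
    Complex.norm_ofNat, Real.norm_eq_abs, mul_pow, sq_abs]
  ring

/-- The energy of the transform at frequencies of modulus at most `s`. -/
noncomputable def bandEnergy (f : ℝ → ℂ) (s : ℝ) : ℝ :=
  ∫ t in (0 : ℝ)..s, (‖transform f t‖ ^ 2 + ‖transform f (-t)‖ ^ 2)

lemma intervalIntegrable_dataDensity {f : ℝ → ℂ} (hf : IntegrableOn f Ω) {u : ℝ → ℝ → ℂ} {K : ℝ}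
    (hK : 0 ≤ K) (h : ∀ α ∈ Ioo 0 K, IsOutgoingSolution α f fun x => u x α) :
    IntervalIntegrable (dataDensity u) volume 0 K := by
  have hc := continuous_transform hf
  have hi : IntervalIntegrable
      (fun α => 1 / 4 * (‖transform f α‖ ^ 2 + ‖transform f (-α)‖ ^ 2)) volume 0 K :=
    (by fun_prop : Continuous _).intervalIntegrable _ _
  rw [intervalIntegrable_iff_integrableOn_Ioo_of_le hK] at hi ⊢
  exact hi.congr_fun (fun α hα => (dataDensity_eq hf (h α hα)).symm) measurableSet_Ioo

lemma bandEnergy_eq_dataSize {f : ℝ → ℂ} (hf : IntegrableOn f Ω) {u : ℝ → ℝ → ℂ} {K : ℝ}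
    (hK : 0 ≤ K) (h : ∀ α ∈ Ioo 0 K, IsOutgoingSolution α f fun x => u x α) :
    bandEnergy f K = 4 * dataSize K u ^ 2 := by
  have h1 : ∫ α in (0 : ℝ)..K, dataDensity u α = 1 / 4 * bandEnergy f K := by
    rw [bandEnergy, ← intervalIntegral.integral_const_mul, intervalIntegral.integral_of_le hK,
      intervalIntegral.integral_of_le hK, integral_Ioc_eq_integral_Ioo,
      integral_Ioc_eq_integral_Ioo]
    exact setIntegral_congr_fun measurableSet_Ioo fun α hα => dataDensity_eq hf (h α hα)
  have h0 : 0 ≤ bandEnergy f K := intervalIntegral.integral_nonneg hK fun _ _ => by positivity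
  rw [dataSize, h1, Real.sq_sqrt (by positivity)]
  ring

/-! ### Splitting the energy at a cutoff frequency -/

lemma l2NormSq_le_bandEnergy_add {f g : ℝ → ℂ} (hf : MemL2 f) (hg : MemL2 g)
    (hfg : HasWeakDeriv f g) (hsupp : SupportedInside f) {s : ℝ} (hs : 0 < s) :
    2 * Real.pi * l2NormSq f ≤ bandEnergy f s + 2 * Real.pi * (l2NormSq g / s ^ 2) := by
  have hc := continuous_transform hf.integrable
  have hi := integrable_sq_transform hf
  have hig := integrable_sq_transform hg
  have hband : bandEnergy f s = ∫ ξ in Ioc (-s) s, ‖transform f ξ‖ ^ 2 := by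
    have hii : ∀ a b, IntervalIntegrable (fun t => ‖transform f t‖ ^ 2) volume a b :=
      fun a b => (by fun_prop : Continuous _).intervalIntegrable _ _
    have hneg := intervalIntegral.integral_comp_neg (a := 0) (b := s)
      (fun t => ‖transform f t‖ ^ 2)
    rw [neg_zero] at hneg
    rw [bandEnergy, intervalIntegral.integral_add (hii _ _)
      ((by fun_prop : Continuous _).intervalIntegrable _ _), hneg, add_comm,
      intervalIntegral.integral_add_adjacent_intervals (hii _ _) (hii _ _),
      intervalIntegral.integral_of_le (by linarith)]
  rw [← integral_sq_transform hf, hband, ← integral_indicator measurableSet_Ioc,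
    mul_div_assoc', ← integral_sq_transform hg, ← integral_div,
    ← integral_add (hi.indicator measurableSet_Ioc) (hig.div_const _)]
  refine integral_mono hi ((hi.indicator measurableSet_Ioc).add (hig.div_const _)) fun ξ => ?_
  have hG : ‖transform g ξ‖ ^ 2 = ξ ^ 2 * ‖transform f ξ‖ ^ 2 := by
    rw [hfg.transform_eq hsupp hf.integrable hg.integrable]
    simp [mul_pow]
  by_cases hξ : ξ ∈ Ioc (-s) s
  · simp only [indicator_of_mem hξ]
    linarith [show 0 ≤ ‖transform g ξ‖ ^ 2 / s ^ 2 by positivity]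
  · simp only [indicator_of_notMem hξ, zero_add]
    rw [le_div_iff₀ (by positivity), hG, mul_comm]
    refine mul_le_mul_of_nonneg_right (sq_le_sq.2 ?_) (by positivity)
    rw [abs_of_pos hs]
    by_contra! hlt
    exact hξ ⟨(abs_lt.1 hlt).1, (abs_lt.1 hlt).2.le⟩

lemma bandEnergy_mono {f : ℝ → ℂ} (hf : IntegrableOn f Ω) {s t : ℝ} (hs : 0 ≤ s) (hst : s ≤ t) :
    bandEnergy f s ≤ bandEnergy f t := by
  have hc := continuous_transform hf
  exact intervalIntegral.integral_mono_interval le_rfl hs hst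
    (.of_forall fun _ => by positivity) ((by fun_prop : Continuous _).intervalIntegrable _ _)

lemma bandEnergy_le {f : ℝ → ℂ} (hf : MemL2 f) {s : ℝ} (hs : 1 ≤ s) :
    bandEnergy f s ≤ 180 * Real.exp (33 * s ^ 2) * bandEnergy f 1 +
      16 * s * Real.exp (-4 * s) * l2NormSq f := by
  have hc := continuous_transform hf.integrable
  have hsplit : ∀ b, bandEnergy f b = (∫ t in (0 : ℝ)..b, ‖transform f (1 * t)‖ ^ 2) +
      ∫ t in (0 : ℝ)..b, ‖transform f (-1 * t)‖ ^ 2 := by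
    intro b
    rw [bandEnergy, ← intervalIntegral.integral_add
      ((by fun_prop : Continuous _).intervalIntegrable _ _)
      ((by fun_prop : Continuous _).intervalIntegrable _ _)]
    simp only [one_mul, neg_one_mul]
  have h1 := integral_sq_transform_le hf (σ := 1) (by simp) hs
  have h2 := integral_sq_transform_le hf (σ := -1) (by simp) hs
  rw [hsplit, hsplit 1]
  linarith

/-- The stability estimate with a free cutoff frequency `s`. -/
lemma l2NormSq_le_exp_mul_add {f g : ℝ → ℂ} (hf : MemL2 f) (hg : MemL2 g)
    (hfg : HasWeakDeriv f g) (hsupp : SupportedInside f) {s : ℝ} (hs : 1 ≤ s) :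
    l2NormSq f ≤ 180 * Real.exp (33 * s ^ 2) * bandEnergy f 1 +
      16 * (l2NormSq f + l2NormSq g) / s ^ 2 := by
  have hs0 : 0 < s := by linarith
  have h1 := l2NormSq_le_bandEnergy_add hf hg hfg hsupp hs0
  have h2 := bandEnergy_le hf hs
  have hfn := l2NormSq_nonneg f
  have hgn := l2NormSq_nonneg g
  have hpi := Real.pi_gt_three
  have hpi4 := Real.pi_lt_four
  have hb : 0 ≤ bandEnergy f 1 :=
    intervalIntegral.integral_nonneg zero_le_one fun _ _ => by positivity
  have h3 : s * Real.exp (-4 * s) ≤ 1 / s ^ 2 := by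
    have hse : s ≤ Real.exp s := by linarith [Real.add_one_le_exp s]
    rw [le_div_iff₀ (by positivity)]
    calc s * Real.exp (-4 * s) * s ^ 2 = s ^ 3 * Real.exp (-4 * s) := by ring
      _ ≤ Real.exp s ^ 3 * Real.exp (-4 * s) := by gcongr
      _ = Real.exp (-s) := by rw [← Real.exp_nat_mul, ← Real.exp_add]; ring_nf
      _ ≤ 1 := Real.exp_le_one_iff.2 (by linarith)
  have h4 : 16 * s * Real.exp (-4 * s) * l2NormSq f ≤ 16 * (l2NormSq f / s ^ 2) := by
    calc _ = 16 * (s * Real.exp (-4 * s)) * l2NormSq f := by ring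
      _ ≤ 16 * (1 / s ^ 2) * l2NormSq f := by gcongr
      _ = _ := by ring
  have h5 : 0 ≤ l2NormSq f / s ^ 2 := by positivity
  have h6 : 0 ≤ l2NormSq g / s ^ 2 := by positivity
  have h7 : 0 ≤ 180 * Real.exp (33 * s ^ 2) * bandEnergy f 1 := by positivity
  have h8 : 16 * (l2NormSq f + l2NormSq g) / s ^ 2 =
      16 * (l2NormSq f / s ^ 2) + 16 * (l2NormSq g / s ^ 2) := by ring
  rw [h8]
  nlinarith

/-! ### The choice of the cutoff frequency -/

/-- With `r = K^(2/3) E^(1/4)` as the square of the cutoff frequency, a cutoff above `K` makes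
`E = -ln ε` so large that `ε²` beats the amplification `e^(33 r)`. -/
lemma exp_mul_sq_le {K ε : ℝ} (hK : 1 < K) (hε : 0 < ε)
    (hr : K ^ 2 < K ^ (2 / 3 : ℝ) * (max (-Real.log ε) 0) ^ (1 / 4 : ℝ)) :
    Real.exp (33 * (K ^ (2 / 3 : ℝ) * (max (-Real.log ε) 0) ^ (1 / 4 : ℝ))) * ε ^ 2 ≤
      Real.exp 145 / (1 + K ^ (2 / 3 : ℝ) * (max (-Real.log ε) 0) ^ (1 / 4 : ℝ)) := by
  set E := max (-Real.log ε) 0 with hE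
  set r := K ^ (2 / 3 : ℝ) * E ^ (1 / 4 : ℝ) with hrdef
  have hK0 : 0 < K := by linarith
  have hE0 : 0 ≤ E := le_max_right _ _
  -- in the variables `a = K^(2/3)` and `b = E^(1/4)` the assumption reads `a² < b`
  set a := K ^ (2 / 3 : ℝ) with ha
  set b := E ^ (1 / 4 : ℝ) with hb
  have ha1 : 1 < a := Real.one_lt_rpow hK (by norm_num)
  have ha3 : a ^ 3 = K ^ 2 := by
    rw [ha, ← Real.rpow_natCast, ← Real.rpow_mul hK0.le, ← Real.rpow_natCast]
    norm_num
  have hb4 : b ^ 4 = E := by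
    rw [hb, ← Real.rpow_natCast, ← Real.rpow_mul hE0]
    norm_num
  have hab : a ^ 2 < b := by
    rw [← ha3] at hr
    have : a * a ^ 2 < a * b := by calc a * a ^ 2 = a ^ 3 := by ring
      _ < a * b := hr
    exact lt_of_mul_lt_mul_left this (by linarith)
  have hb1 : 1 < b := by nlinarith
  have hr0 : 0 < r := by rw [hrdef]; positivity
  have hrE : r ^ 2 ≤ E := by
    calc r ^ 2 = a ^ 2 * b ^ 2 := by rw [hrdef]; ring
      _ ≤ b * b ^ 2 := by gcongr
      _ = b ^ 3 := by ring
      _ ≤ b ^ 4 := pow_le_pow_right₀ hb1.le (by norm_num)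
      _ = E := hb4
  have hEpos : 0 < E := lt_of_lt_of_le (by positivity) hrE
  have hElog : E = -Real.log ε := by
    rcases max_choice (-Real.log ε) 0 with h | h
    · rw [hE, h]
    · rw [← hE] at h; linarith
  have hε2 : ε ^ 2 = Real.exp (-2 * E) := by
    rw [hElog, show -2 * -Real.log ε = Real.log ε + Real.log ε by ring, Real.exp_add,
      Real.exp_log hε, sq]
  rw [le_div_iff₀ (by positivity), hε2, ← Real.exp_add]
  calc _ ≤ Real.exp (33 * r + -2 * E) * Real.exp r := by
        gcongr
        linarith [Real.add_one_le_exp r]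
    _ = Real.exp (33 * r + -2 * E + r) := (Real.exp_add _ _).symm
    _ ≤ Real.exp 145 := Real.exp_le_exp.2 (by nlinarith [sq_nonneg (2 * r - 17)])

end Helmholtz

theorem theorem1p1 :
    ∃ C : ℝ, 0 < C ∧ ∀ (K : ℝ) (f : ℝ → ℂ) (u : ℝ → ℝ → ℂ), 1 < K →
      Helmholtz.MemH1 f → Helmholtz.SupportedInside f →
      (∀ α ∈ Set.Ioo 0 K, Helmholtz.IsOutgoingSolution α f (fun x => u x α)) →
      IntervalIntegrable (Helmholtz.dataDensity u) MeasureTheory.volume 0 K ∧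
      Helmholtz.l2NormSq f ≤ C * (Helmholtz.dataSize K u ^ 2 +
        Helmholtz.tailTerm K (max (Helmholtz.h1NormSq f) 1) (Helmholtz.dataSize K u)) := by
  open Helmholtz in
  refine ⟨720 * Real.exp 145 + 32, by positivity, fun K f u hK hf hsupp hu => ?_⟩
  have hK0 : 0 < K := by linarith
  have hfL2 : MemL2 f := hf.1
  have hfi := hfL2.integrable
  refine ⟨intervalIntegrable_dataDensity hfi hK0.le hu, ?_⟩
  set g := weakDeriv f with hg
  have hgspec : MemL2 g ∧ HasWeakDeriv f g := by
    rw [hg, weakDeriv, dif_pos hf.2]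
    exact hf.2.choose_spec
  set H := h1NormSq f with hH
  have hHeq : H = l2NormSq f + l2NormSq g := rfl
  have hfn := l2NormSq_nonneg f
  have hgn := l2NormSq_nonneg g
  set ε := dataSize K u with hεdef
  have hε0 : 0 ≤ ε := Real.sqrt_nonneg _
  have hband : bandEnergy f K = 4 * ε ^ 2 := bandEnergy_eq_dataSize hfi hK0.le hu
  have hband1 : bandEnergy f 1 ≤ 4 * ε ^ 2 := hband ▸ bandEnergy_mono hfi zero_le_one hK.le
  have hkey : ∀ s : ℝ, 1 ≤ s →
      l2NormSq f ≤ 720 * Real.exp (33 * s ^ 2) * ε ^ 2 + 16 * H / s ^ 2 := by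
    intro s hs
    have h1 := l2NormSq_le_exp_mul_add hfL2 hgspec.1 hgspec.2 hsupp hs
    have h2 : 180 * Real.exp (33 * s ^ 2) * bandEnergy f 1 ≤
        180 * Real.exp (33 * s ^ 2) * (4 * ε ^ 2) := by gcongr
    rw [hHeq]
    linarith
  rcases hε0.eq_or_lt with hε | hε
  · -- vanishing data: the cutoff frequency tends to infinity
    rw [← hε, tailTerm, if_pos rfl]
    have hlim : Filter.Tendsto (fun s : ℝ => 16 * H / s ^ 2) Filter.atTop (nhds 0) :=
      tendsto_const_nhds.div_atTop (Filter.tendsto_pow_atTop two_ne_zero)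
    have := ge_of_tendsto hlim (by
      filter_upwards [Filter.eventually_ge_atTop 1] with s hs
      simpa [← hε] using hkey s hs)
    simpa using this
  set M := max H 1 with hM
  have hM1 : 1 ≤ M := le_max_right _ _
  have hHM : H ≤ M ^ 2 := (le_max_left H 1).trans (by nlinarith)
  rw [tailTerm, if_neg hε.ne']
  set r := K ^ (2 / 3 : ℝ) * (max (-Real.log ε) 0) ^ (1 / 4 : ℝ) with hr
  have hr0 : 0 ≤ r := by positivity
  have hexp : (0 : ℝ) < Real.exp 145 := Real.exp_pos _
  have hT : 0 ≤ M ^ 2 / (1 + r) := by positivity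
  rcases le_or_gt r (K ^ 2) with hrK | hrK
  · -- the cutoff frequency `K`
    have h1 := l2NormSq_le_bandEnergy_add hfL2 hgspec.1 hgspec.2 hsupp hK0
    have h2 : l2NormSq g / K ^ 2 ≤ 2 * (M ^ 2 / (1 + r)) := by
      rw [mul_div_assoc', div_le_div_iff₀ (by positivity) (by positivity)]
      have : 1 + r ≤ 2 * K ^ 2 := by nlinarith
      calc l2NormSq g * (1 + r) ≤ M ^ 2 * (2 * K ^ 2) := by
            gcongr
            linarith
        _ = _ := by ring
    have hpi := Real.pi_gt_three
    rw [hband] at h1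
    have h3 : l2NormSq f ≤ ε ^ 2 + l2NormSq g / K ^ 2 := by
      by_contra! hcon
      nlinarith [sq_nonneg ε]
    nlinarith [sq_nonneg ε]
  · -- the cutoff frequency `√r`, which exceeds `K`
    have hr1 : 1 ≤ r := by nlinarith
    have h1 := hkey (Real.sqrt r) (Real.one_le_sqrt.2 hr1)
    rw [Real.sq_sqrt hr0] at h1
    have h2 := exp_mul_sq_le hK hε hrK
    rw [← hr] at h2
    have h3 : Real.exp 145 / (1 + r) ≤ Real.exp 145 * (M ^ 2 / (1 + r)) := by
      rw [mul_div_assoc']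
      gcongr
      exact le_mul_of_one_le_right hexp.le (one_le_pow₀ hM1)
    have h4 : 16 * H / r ≤ 32 * (M ^ 2 / (1 + r)) := by
      rw [mul_div_assoc', div_le_div_iff₀ (by positivity) (by positivity)]
      calc 16 * H * (1 + r) ≤ 16 * M ^ 2 * (2 * r) := by
            gcongr
            linarith
        _ = _ := by ring
    have h5 : 0 ≤ (720 * Real.exp 145 + 32) * ε ^ 2 := by positivity
    linarith
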